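/- Let $K$ be a field of characteristic $0$, let $t\in K$ be transcendental over $\mathbb{Q}$ (an indeterminate), and let $n\ge 1$. For $v\in\mathbb{Z}^n$ write $v\ge 0$ if $v_k+v_{k+1}+\cdots+v_n\ge 0$ for all $k=1,\dots,n$. Let $L$ be the $K$-vector space of formal Laurent series $\sum_{v\in\mathbb{Z}^n}a_v x^v$ in $x_1,\dots,x_n$ with only finitely many nonzero terms such that $v\ge 0$. Let $N\subseteq L$ be the subspace spanned by the straightening relations $$(x^v+x^{vs_i})(x_{i+1}-t\,x_i)\quad(1\le i\le n-1,\ v\in\mathbb{Z}^n),\qquad x^v\quad(v\in\mathbb{Z}^n,\ v_n<0),$$ where $vs_i$ is $v$ with $v_i,v_{i+1}$ exchanged, together with all series having no term with $v\ge 0$. Let $\mathrm{Part}$ be the set of partitions $\lambda=(\lambda_1\ge\cdots\ge\lambda_n\ge 0)$ in $\mathbb{N}^n$. For $\lambda\in\mathrm{Part}$ put $|\lambda|=\sum_i\lambda_i$ and $b_\lambda=\prod_{k\ge 1}\prod_{j=1}^{m_k}(1-t^j)$, where $m_k$ is the number of parts of $\lambda$ equal to $k$. For $\lambda,\mu\in\mathrm{Part}$,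 with conjugates $\lambda^\sim,\mu^\sim$, put $$\mathbf{n}(\lambda/\mu)=\sum_{j\ge 1}\frac{(\lambda^\sim_j-\mu^\sim_j)(\lambda^\sim_j-\mu^\sim_j-1)}{2},\qquad \theta(\lambda,\mu)=t^{\mathbf{n}(\lambda/\mu)-|\mu|}.$$ Proposition. There is exactly one bilinear form $((\cdot,\cdot))$ on $L/N$ such that $((x^\lambda,x^\mu))=b_\lambda\,\delta_{\lambda,\mu}$ for all $\lambda,\mu\in\mathrm{Part}$. For this form and all $\lambda,\mu\in\mathrm{Part}$, $$\left(\!\left(\frac{t^{-|\lambda|}\,x^\lambda}{\prod_{i=1}^n(1-t/x_i)}\,,\ \frac{x^\mu}{\prod_{i=1}^n(1-1/x_i)}\right)\!\right)=\theta(\lambda,\mu),$$ where $\frac{x^w}{\prod_i(1-c/x_i)}$ denotes the series $\sum_{u\in\mathbb{N}^n}c^{u_1+\cdots+u_n}x^{w-u}\in L$. -/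

import Mathlib

namespace HallLittlewood

/-- Exponents `v ∈ ℤⁿ` with `v ≥ [0,…,0]`: for every `k`, the tail sum `v_k + ⋯ + v_n` is
nonnegative. -/
def TailNonneg {n : ℕ} (v : Fin n → ℤ) : Prop :=
  ∀ k : Fin n, 0 ≤ ∑ i ∈ Finset.Ici k, v i

/-- The last coordinate of `v` is negative: `v_n < 0`. -/
def LastNeg {n : ℕ} (v : Fin n → ℤ) : Prop :=
  ∃ i : Fin n, (i : ℕ) + 1 = n ∧ v i < 0

/-- The space of formal Laurent series in `x_1, …, x_n` over `K` having only finitely many terms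
with exponent `≥ [0,…,0]`. A series is given by its coefficient function. -/
def LaurentSeriesSpace (K : Type*) [Field K] (n : ℕ) : Submodule K ((Fin n → ℤ) → K) where
  carrier := {f | {v | TailNonneg v ∧ f v ≠ 0}.Finite}
  zero_mem' := by simp
  add_mem' := by
    intro f g hf hg
    refine (Set.Finite.union hf hg).subset ?_
    rintro v ⟨hv, hne⟩
    by_cases h : f v = 0
    · exact Or.inr ⟨hv, fun h' => hne (by simp [h, h'])⟩
    · exact Or.inl ⟨hv, h⟩
  smul_mem' := by
    intro c f hf
    refine Set.Finite.subset hf ?_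
    rintro v ⟨hv, hne⟩
    exact ⟨hv, fun h => hne (by simp [h])⟩

/-- The Laurent monomial `x^v`, `v ∈ ℤⁿ`. -/
def mono (K : Type*) [Field K] {n : ℕ} (v : Fin n → ℤ) : LaurentSeriesSpace K n :=
  ⟨Pi.single v 1, (Set.finite_singleton v).subset (by
    rintro w ⟨_, hne⟩
    by_contra h
    exact hne (Pi.single_eq_of_ne h _))⟩

/-- The subspace of relations. It is spanned by
* `(x^v + x^{v s_i}) (x_{i+1} - t x_i)`, for `v ∈ ℤⁿ` and adjacent indices `i`, `j = i + 1`;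
* `x^v` for `v_n < 0`;
* the series without any term of exponent `≥ [0,…,0]`; such monomials vanish by the first two
  kinds of relations, and an infinite combination of them vanishes as well. -/
def relations {K : Type*} [Field K] (n : ℕ) (t : K) : Submodule K (LaurentSeriesSpace K n) :=
  Submodule.span K
    ({f | ∃ (v : Fin n → ℤ) (i j : Fin n), (i : ℕ) + 1 = j ∧
        f = mono K (v + Pi.single j 1) + mono K (v ∘ Equiv.swap i j + Pi.single j 1)
          - t • mono K (v + Pi.single i 1) - t • mono K (v ∘ Equiv.swap i j + Pi.single i 1)} ∪
     {f | ∃ v : Fin n → ℤ, LastNeg v ∧ f = mono K v} ∪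
     {f | ∀ v, TailNonneg v → f.1 v = 0})

/-- Laurent series modulo the straightening relations. -/
abbrev Straightened {K : Type*} [Field K] (n : ℕ) (t : K) : Type _ :=
  LaurentSeriesSpace K n ⧸ relations n t

/-- The class of a Laurent series modulo the straightening relations. -/
abbrev cls {K : Type*} [Field K] {n : ℕ} (t : K) (f : LaurentSeriesSpace K n) :
    Straightened n t :=
  (relations n t).mkQ f

/-- Partitions of length at most `n`, as weakly decreasing elements of `ℕⁿ`. -/
abbrev Part (n : ℕ) : Type := {lam : Fin n → ℕ // Antitone lam}

namespace Part

variable {n : ℕ}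

/-- The partition as an exponent in `ℤⁿ`. -/
def exponent (lam : Part n) : Fin n → ℤ := fun i => (lam.1 i : ℤ)

/-- The weight `|λ|`. -/
def size (lam : Part n) : ℕ := ∑ i, lam.1 i

/-- The part `λ~_j` of the conjugate partition, `j ≥ 1`. -/
def conj (lam : Part n) (j : ℕ) : ℕ := (Finset.univ.filter fun i => j ≤ lam.1 i).card

/-- The multiplicity `m_k` of the part `k` in `λ`. -/
def mult (lam : Part n) (k : ℕ) : ℕ := (Finset.univ.filter fun i => lam.1 i = k).card

/-- `n(λ/μ) = ∑_{j ≥ 1} (λ~_j - μ~_j)(λ~_j - μ~_j - 1)/2`; the terms with `j > |λ| + |μ|`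
vanish, and the division by `2` is exact. -/
def nSkew (lam mu : Part n) : ℤ :=
  ∑ j ∈ Finset.Icc 1 (lam.size + mu.size),
    ((lam.conj j : ℤ) - mu.conj j) * ((lam.conj j : ℤ) - mu.conj j - 1) / 2

/-- `b_λ = ∏_{k ≥ 1} ∏_{j = 1}^{m_k} (1 - t^j)`; the factors with `k > |λ|` are `1`. -/
def b {K : Type*} [Field K] (t : K) (lam : Part n) : K :=
  ∏ k ∈ Finset.Icc 1 lam.size, ∏ j ∈ Finset.Icc 1 (lam.mult k), (1 - t ^ j)

/-- `θ(λ,μ) = t^{n(λ/μ) - |μ|}`. -/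
def theta {K : Type*} [Field K] (t : K) (lam mu : Part n) : K :=
  t ^ (nSkew lam mu - (mu.size : ℤ))

end Part

/-- Coefficients of the expansion
`x^w ∏_i (1 - c/x_i)⁻¹ = ∑_{u ∈ ℕⁿ} c^{|u|} x^{w - u}`, a product of geometric series. -/
def geomCoeff {K : Type*} [Field K] {n : ℕ} (c : K) (w v : Fin n → ℤ) : K :=
  ∏ i, if v i ≤ w i then c ^ (w i - v i).toNat else 0

/-- The Laurent series `x^w / ∏_i (1 - c/x_i)`, expanded in powers of the `1/x_i`. -/
def geom {K : Type*} [Field K] {n : ℕ} (c : K) (w : Fin n → ℤ) : LaurentSeriesSpace K n :=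
  ⟨geomCoeff c w, by
    have hsub : {v | TailNonneg v ∧ geomCoeff c w v ≠ 0} ⊆
        Set.Icc (fun i => w i - ∑ j, w j) w := by
      rintro v ⟨hv, hne⟩
      have hle : ∀ i, v i ≤ w i := by
        intro i
        by_contra h
        exact hne (Finset.prod_eq_zero (Finset.mem_univ i) (if_neg h))
      refine ⟨fun i => ?_, hle⟩
      have hpos : 0 < n := i.pos
      have h0 : 0 ≤ ∑ j, v j := by
        have := hv ⟨0, hpos⟩
        have hI : Finset.Ici (⟨0, hpos⟩ : Fin n) = Finset.univ := by
          ext j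
          simp [Fin.le_def]
        rwa [hI] at this
      have h1 : w i - v i ≤ ∑ j, (w j - v j) :=
        Finset.single_le_sum (f := fun j => w j - v j)
          (fun j _ => sub_nonneg.2 (hle j)) (Finset.mem_univ i)
      rw [Finset.sum_sub_distrib] at h1
      show w i - ∑ j, w j ≤ v i
      linarith
    exact (Set.finite_Icc _ _).subset hsub⟩

/-- Multiplying `geom c w` by `∏_i (1 - c/x_i) = ∑_s (-c)^{|s|} x^{-1_s}` gives back `x^w`. -/
theorem geom_mul_denominator {K : Type*} [Field K] {n : ℕ} (c : K) (w v : Fin n → ℤ) :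
    ∑ s : Finset (Fin n), (-c) ^ s.card * (geom c w).1 (fun i => v i + if i ∈ s then 1 else 0)
      = (mono K w).1 v := by
  have hfac : ∀ i, (-c) * (if v i + 1 ≤ w i then c ^ (w i - (v i + 1)).toNat else 0)
      + (if v i ≤ w i then c ^ (w i - v i).toNat else 0) = if v i = w i then (1 : K) else 0 := by
    intro i
    rcases lt_trichotomy (v i) (w i) with h | h | h
    · have e : (w i - v i).toNat = (w i - (v i + 1)).toNat + 1 := by omega
      rw [if_pos (by omega), if_pos h.le, if_neg h.ne, e, pow_succ]
      ring
    · simp [h]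
    · rw [if_neg (by omega), if_neg (by omega), if_neg h.ne']
      ring
  have hR : (mono K w).1 v = ∏ i, if v i = w i then (1 : K) else 0 := by
    by_cases h : v = w
    · subst h
      simp [mono]
    · obtain ⟨i, hi⟩ := Function.ne_iff.1 h
      rw [Finset.prod_eq_zero (Finset.mem_univ i) (if_neg hi)]
      exact Pi.single_eq_of_ne h _
  rw [hR, ← Finset.prod_congr rfl (fun i _ => hfac i), Fintype.prod_add]
  refine Finset.sum_congr rfl fun s _ => ?_
  rw [Finset.prod_mul_distrib, Finset.prod_const, mul_assoc]
  congr 1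
  show geomCoeff c w _ = _
  unfold geomCoeff
  rw [← Finset.prod_mul_prod_compl s]
  congr 1
  · exact Finset.prod_congr rfl fun i hi => by simp [hi]
  · exact Finset.prod_congr rfl fun i hi => by simp [Finset.mem_compl.1 hi]

/-- The defining property of the scalar product: it is the bilinear form with
`((x^λ, x^μ)) = b_λ δ_{λμ}` on dominant monomials. -/
def IsScalarProduct {K : Type*} [Field K] {n : ℕ} (t : K)
    (B : LinearMap.BilinForm K (Straightened n t)) : Prop :=
  ∀ lam mu : Part n,
    B (cls t (mono K lam.exponent)) (cls t (mono K mu.exponent)) =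
      if lam = mu then lam.b t else 0

end HallLittlewood

/-! Existence and uniqueness of the form amount to the dominant monomials being a basis of the
quotient. They span by straightening (`span_cls_part`). For independence, the alternants `∑_σ ±
σ(x^v ∏_{a<b} (x_a - t x_b))` obey the same relations as the `x^v`, and they are independent for
antitone `v`: at `t = 0` they become the ordinary alternants, and `t` is transcendental
(`linearIndependent_alternant`). Their coordinate functionals descend to the quotient.

For the formula, multiplying by `∏ (1 - c/x_i)` writes `x^λ` as a finite alternating sum of the
series attached to `λ - 1_S`. The values of the form on the series thus satisfy a triangular system
whose right-hand side is the Gram matrix `b_λ δ_{λμ}`. Sorting `λ - 1_S` only ever exchanges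
adjacent entries `a, a + 1`, at the cost of a factor `t` (`cls_geom_of_succ`). The function `θ`,
extended to all exponents as `pairing`, has the same sorting rule and solves the same system
(`sum_sum_pairing_lower`), because for a fixed second argument it is a product over the coordinates
of the first. Induction on `|λ| + |μ|` then identifies the two (`geomPairing_eq_pairing`). -/

namespace HallLittlewood

/-! ### Straightening to antitone exponents. -/

/-- A family indexed by `ℤⁿ` satisfies the straightening relations. -/
def Straightens {K M : Type*} [Field K] [AddCommGroup M] [Module K M] {n : ℕ} (t : K)
    (m : (Fin n → ℤ) → M) : Prop :=
  ∀ (v : Fin n → ℤ) (i j : Fin n), (i : ℕ) + 1 = j →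
    m (v + Pi.single j 1) + m (v ∘ Equiv.swap i j + Pi.single j 1)
      - t • m (v + Pi.single i 1) - t • m (v ∘ Equiv.swap i j + Pi.single i 1) = 0

/-- Move `d` units from the coordinate `j` to the coordinate `i`. -/
def shift {n : ℕ} (v : Fin n → ℤ) (i j : Fin n) (d : ℤ) : Fin n → ℤ :=
  v + Pi.single i d - Pi.single j d

theorem shift_eq_comp_swap {n : ℕ} (v : Fin n → ℤ) {i j : Fin n} (hij : i ≠ j) :
    shift v i j (v j - v i) = v ∘ Equiv.swap i j := by
  funext k
  rcases eq_or_ne k i with rfl | hi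
  · simp [shift, hij]
  · rcases eq_or_ne k j with rfl | hj
    · simp [shift, hi]
    · simp [shift, hi, hj, Equiv.swap_apply_of_ne_of_ne]

theorem sum_shift_mul {n : ℕ} (v c : Fin n → ℤ) (i j : Fin n) (d : ℤ) :
    ∑ k, c k * shift v i j d k = ∑ k, c k * v k + d * (c i - c j) := by
  simp only [shift, Pi.add_apply, Pi.sub_apply, mul_sub, mul_add, Finset.sum_add_distrib,
    Finset.sum_sub_distrib]
  simp only [Pi.single_apply, mul_ite, mul_zero, Finset.sum_ite_eq', Finset.mem_univ, if_true]
  ring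

theorem sum_Ici_shift_le {n : ℕ} (v : Fin n → ℤ) {i j : Fin n} (hij : i ≤ j) {d : ℤ}
    (hd : 0 ≤ d) (k : Fin n) :
    ∑ l ∈ Finset.Ici k, shift v i j d l ≤ ∑ l ∈ Finset.Ici k, v l := by
  have h : ∀ w : Fin n → ℤ, ∑ l ∈ Finset.Ici k, w l = ∑ l, (if k ≤ l then 1 else 0) * w l := by
    intro w
    simp [← Finset.sum_filter, ← Finset.filter_le_eq_Ici]
  rw [h, h, sum_shift_mul]
  have : (if k ≤ i then (1 : ℤ) else 0) ≤ if k ≤ j then 1 else 0 := by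
    split_ifs <;> omega
  nlinarith

section

variable {K M : Type*} [Field K] [AddCommGroup M] [Module K M] {n : ℕ} {t : K}
  {m : (Fin n → ℤ) → M}

/-- This is the relation at `v - e_j`, solved for its leading term. With gap `g = v j - v i`, its
four exponents are the shifts of `v` by `0`, `1`, `g - 1` and `g`. -/
theorem Straightens.eq_shift (hm : Straightens t m) (v : Fin n → ℤ) {i j : Fin n}
    (hij : (i : ℕ) + 1 = j) :
    m v = t • m (shift v i j (v j - v i)) + t • m (shift v i j 1)
      - m (shift v i j (v j - v i - 1)) := by
  have hne : i ≠ j := by rintro rfl; omega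
  have h := hm (v - Pi.single j 1) i j hij
  have e1 : v - Pi.single j 1 + Pi.single j 1 = v := by simp
  have e2 : (v - Pi.single j 1) + Pi.single i 1 = shift v i j 1 := by
    simp only [shift]; abel
  have e3 : (v - Pi.single j 1) ∘ Equiv.swap i j + Pi.single i 1 = shift v i j (v j - v i) := by
    funext k
    rcases eq_or_ne k i with rfl | hi
    · simp [shift, hne]
    · rcases eq_or_ne k j with rfl | hj
      · simp [shift, hi, hne]
      · simp [shift, hi, hj, Equiv.swap_apply_of_ne_of_ne]
  have e4 : (v - Pi.single j 1) ∘ Equiv.swap i j + Pi.single j 1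
      = shift v i j (v j - v i - 1) := by
    funext k
    rcases eq_or_ne k i with rfl | hi
    · simp [shift, hne]; ring
    · rcases eq_or_ne k j with rfl | hj
      · simp [shift, hi, hne]; ring
      · simp [shift, hi, hj, Equiv.swap_apply_of_ne_of_ne]
  rw [e1, e2, e3, e4] at h
  rw [← sub_eq_zero, ← h]
  abel

/-- For gap `1` the shift by `g - 1` is `v` itself and the other two shifts coincide, so every term
of the relation occurs twice; dividing by `2` needs the characteristic. -/
theorem Straightens.eq_of_succ [CharZero K] (hm : Straightens t m) (v : Fin n → ℤ) {i j : Fin n}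
    (hij : (i : ℕ) + 1 = j) (hv : v j = v i + 1) : m v = t • m (v ∘ Equiv.swap i j) := by
  have hne : i ≠ j := by rintro rfl; omega
  have h := hm.eq_shift v hij
  have e1 : shift v i j 1 = v ∘ Equiv.swap i j := by
    rw [← shift_eq_comp_swap v hne]; congr 1; omega
  have e2 : shift v i j (v j - v i - 1) = v := by
    rw [hv]; simp [shift]
  rw [e2, shift_eq_comp_swap v hne, e1] at h
  have h2 : (2 : K) • (m v - t • m (v ∘ Equiv.swap i j)) = 0 := by
    rw [two_smul, ← sub_eq_zero.2 h]; abel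
  exact sub_eq_zero.1 ((smul_eq_zero.1 h2).resolve_left two_ne_zero)

theorem exists_lt_succ_of_not_antitone {v : Fin n → ℤ} (hv : ¬ Antitone v) :
    ∃ i j : Fin n, (i : ℕ) + 1 = j ∧ v i < v j := by
  by_contra! h
  apply hv
  cases n with
  | zero => exact fun i => i.elim0
  | succ n =>
    exact Fin.antitone_iff_succ_le.2 fun i => h i.castSucc i.succ (by simp)

/-- Straightening: an element `m v` lies in any subspace that contains the `m λ` with `λ`
antitone and dominated by `v` in the sense of tail sums. -/
theorem Straightens.mem_of_antitone [CharZero K] (hm : Straightens t m) (W : Submodule K M)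
    (H : (Fin n → ℤ) → Prop)
    (hH : ∀ v w : Fin n → ℤ,
      (∀ k, ∑ l ∈ Finset.Ici k, w l ≤ ∑ l ∈ Finset.Ici k, v l) → H v → H w)
    (hW : ∀ v, Antitone v → H v → m v ∈ W) (v : Fin n → ℤ) (hv : H v) : m v ∈ W := by
  obtain ⟨c, hc⟩ : ∃ c, ∀ k, c ≤ v k := by
    obtain ⟨c, hc⟩ := (Set.finite_range v).bddBelow
    exact ⟨c, fun k => hc ⟨k, rfl⟩⟩
  -- Moving `d` units from `j = i + 1` to `i` lowers this weighted sum by `d`. The bound `c` keeps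
  -- the sum nonnegative and survives every move with `0 < d ≤ v j - v i`.
  induction hN : (∑ k : Fin n, (k : ℤ) * (v k - c)).toNat using Nat.strong_induction_on
    generalizing v with
  | _ N ih =>
    subst hN
    by_cases ha : Antitone v
    · exact hW v ha hv
    obtain ⟨i, j, hij, hlt⟩ := exists_lt_succ_of_not_antitone ha
    have hne : i ≠ j := by rintro rfl; omega
    have key : ∀ d : ℤ, 0 < d → d ≤ v j - v i → m (shift v i j d) ∈ W := by
      intro d hd hd'
      have hcw : ∀ k, c ≤ shift v i j d k := by
        intro k
        have hk := hc k
        have hi' := hc i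
        rcases eq_or_ne k i with rfl | hi
        · simp [shift, hne]; omega
        · rcases eq_or_ne k j with rfl | hj
          · simp [shift, hi]; omega
          · simp [shift, hi, hj, hk]
      have hnn : 0 ≤ ∑ k : Fin n, (k : ℤ) * (shift v i j d k - c) :=
        Finset.sum_nonneg fun k _ => mul_nonneg (by positivity) (sub_nonneg.2 (hcw k))
      refine ih _ ?_ (shift v i j d) (hH v _ (fun k => sum_Ici_shift_le v ?_ hd.le k) hv) hcw rfl
      · have h1 : ∑ k : Fin n, (k : ℤ) * (shift v i j d k - c)
            = ∑ k : Fin n, (k : ℤ) * (v k - c) - d := by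
          simp only [mul_sub, Finset.sum_sub_distrib]
          rw [sum_shift_mul v (fun k => (k : ℤ)) i j d, ← hij]
          push_cast
          ring
        omega
      · rw [Fin.le_def]; omega
    -- Gap `1` is separate because there the shift by `v j - v i - 1 = 0` gives no descent.
    rcases eq_or_lt_of_le (show v i + 1 ≤ v j by omega) with h1 | h1
    · rw [hm.eq_of_succ v hij h1.symm, ← shift_eq_comp_swap v hne]
      exact W.smul_mem _ (key _ (by omega) le_rfl)
    · rw [hm.eq_shift v hij]
      exact W.sub_mem (W.add_mem (W.smul_mem _ (key _ (by omega) le_rfl))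
        (W.smul_mem _ (key _ (by omega) (by omega)))) (key _ (by omega) (by omega))

end

/-! ### Dominant monomials span the quotient. -/

section

variable {K : Type*} [Field K] {n : ℕ} (t : K)

theorem straightens_cls_mono : Straightens t fun v : Fin n → ℤ => cls t (mono K v) := by
  intro v i j hij
  simp only [cls, ← map_add, ← map_sub, ← map_smul]
  exact (Submodule.Quotient.mk_eq_zero _).2 (Submodule.subset_span (Or.inl (Or.inl
    ⟨v, i, j, hij, rfl⟩)))

theorem cls_eq_zero_of_tailNonneg {f : LaurentSeriesSpace K n}
    (hf : ∀ v, TailNonneg v → f.1 v = 0) : cls t f = 0 :=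
  (Submodule.Quotient.mk_eq_zero _).2 (Submodule.subset_span (Or.inr hf))

theorem mono_apply (v w : Fin n → ℤ) : (mono K v).1 w = if w = v then 1 else 0 := by
  simp [mono, Pi.single_apply]

theorem cls_mono_eq_zero {v : Fin n → ℤ} (hv : ¬ TailNonneg v) : cls t (mono K v) = 0 := by
  refine cls_eq_zero_of_tailNonneg t fun w hw => ?_
  rw [mono_apply, if_neg]
  rintro rfl
  exact hv hw

theorem LastNeg.not_tailNonneg {v : Fin n → ℤ} (hv : LastNeg v) : ¬ TailNonneg v := by
  obtain ⟨i, hi, hneg⟩ := hv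
  intro h
  have := h i
  have hI : Finset.Ici i = {i} := by
    ext j
    simp only [Finset.mem_Ici, Fin.le_def, Finset.mem_singleton, Fin.ext_iff]
    have := j.2
    omega
  rw [hI, Finset.sum_singleton] at this
  omega

theorem exists_part_or_lastNeg {v : Fin n → ℤ} (hv : Antitone v) :
    (∃ lam : Part n, v = lam.exponent) ∨ LastNeg v := by
  by_cases h : ∀ i, 0 ≤ v i
  · refine Or.inl ⟨⟨fun i => (v i).toNat, fun i j hij => Int.toNat_le_toNat (hv hij)⟩, ?_⟩
    funext i
    simp [Part.exponent, h i]
  · push Not at h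
    obtain ⟨i, hi⟩ := h
    have hn : 0 < n := i.pos
    exact Or.inr ⟨⟨n - 1, by omega⟩, by simp; omega,
      lt_of_le_of_lt (hv (Fin.le_def.2 (by have := i.2; simp; omega))) hi⟩

/-- The difference of the two sides has no term with nonnegative tail sums, so it is itself a
relation. This replaces infinite series by finite sums. -/
theorem cls_eq_sum (f : LaurentSeriesSpace K n) (S : Finset (Fin n → ℤ))
    (hS : ∀ v, TailNonneg v → f.1 v ≠ 0 → v ∈ S) :
    cls t f = ∑ v ∈ S, f.1 v • cls t (mono K v) := by
  rw [← sub_eq_zero]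
  simp only [cls, ← map_smul, ← map_sum, ← map_sub]
  refine cls_eq_zero_of_tailNonneg t fun w hw => ?_
  have h1 : (∑ v ∈ S, f.1 v • mono K v).1 w = ∑ v ∈ S, f.1 v * (mono K v).1 w := by
    simp
  have h2 : (f - ∑ v ∈ S, f.1 v • mono K v).1 w = f.1 w - (∑ v ∈ S, f.1 v • mono K v).1 w := rfl
  rw [h2, h1]
  simp only [mono_apply, mul_ite, mul_one, mul_zero, Finset.sum_ite_eq]
  split_ifs with h
  · simp
  · rw [sub_zero]
    by_contra h0
    exact h (hS w hw h0)

theorem span_cls_part [CharZero K] :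
    Submodule.span K (Set.range fun lam : Part n => cls t (mono K lam.exponent)) = ⊤ := by
  rw [eq_top_iff]
  rintro x -
  obtain ⟨f, rfl⟩ := (relations n t).mkQ_surjective x
  change cls t f ∈ _
  rw [cls_eq_sum t f f.2.toFinset (fun v h1 h2 => f.2.mem_toFinset.2 ⟨h1, h2⟩)]
  refine Submodule.sum_mem _ fun v _ => Submodule.smul_mem _ _ ?_
  refine (straightens_cls_mono t).mem_of_antitone _ (fun _ => True) (fun _ _ _ _ => trivial)
    (fun w hw _ => ?_) v trivial
  rcases exists_part_or_lastNeg hw with ⟨lam, rfl⟩ | h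
  · exact Submodule.subset_span ⟨lam, rfl⟩
  · rw [cls_mono_eq_zero t h.not_tailNonneg]
    exact Submodule.zero_mem _

end

/-! ### Hall-Littlewood alternants and their linear independence. -/

section

open AddMonoidAlgebra

variable {R : Type*} [CommRing R] {n : ℕ}

/-- The binomial `x_a - τ x_b`. -/
noncomputable def binomial (τ : R) (a b : Fin n) : AddMonoidAlgebra R (Fin n → ℤ) :=
  single (Pi.single a 1) 1 - single (Pi.single b 1) τ

/-- The product `∏_{a < b} (x_{σ a} - τ x_{σ b})`. -/
noncomputable def twistedVandermonde (τ : R) (σ : Equiv.Perm (Fin n)) :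
    AddMonoidAlgebra R (Fin n → ℤ) :=
  ∏ p ∈ Finset.univ.filter (fun p : Fin n × Fin n => p.1 < p.2), binomial τ (σ p.1) (σ p.2)

/-- The antisymmetrization of `x^v ∏_{a < b} (x_a - τ x_b)`: a Hall-Littlewood polynomial times
the Vandermonde product. -/
noncomputable def alternant (τ : R) (v : Fin n → ℤ) : AddMonoidAlgebra R (Fin n → ℤ) :=
  ∑ σ : Equiv.Perm (Fin n),
    ((Equiv.Perm.sign σ : ℤˣ) : ℤ) • (single (v ∘ σ.symm) 1 * twistedVandermonde τ σ)

theorem swap_lt_swap_of_adjacent {i j a b : Fin n} (hij : (i : ℕ) + 1 = j) (hab : a < b)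
    (hne : (a, b) ≠ (i, j)) : Equiv.swap i j a < Equiv.swap i j b := by
  simp only [Equiv.swap_apply_def, Fin.lt_def, Fin.ext_iff, ne_eq, Prod.mk.injEq] at *
  split_ifs <;> omega

/-- An adjacent transposition permutes the factors of all pairs other than `(i, j)` and reverses
that one factor. Multiplying by the reversed factor restores the symmetry. -/
theorem binomial_mul_twistedVandermonde_swap (τ : R) (σ : Equiv.Perm (Fin n)) {i j : Fin n}
    (hij : (i : ℕ) + 1 = j) :
    binomial τ ((σ * Equiv.swap i j) j) ((σ * Equiv.swap i j) i)
        * twistedVandermonde τ (σ * Equiv.swap i j)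
      = binomial τ (σ j) (σ i) * twistedVandermonde τ σ := by
  have hlt : i < j := by rw [Fin.lt_def]; omega
  have hmem : (i, j) ∈ Finset.univ.filter (fun p : Fin n × Fin n => p.1 < p.2) := by simpa
  unfold twistedVandermonde
  rw [← Finset.mul_prod_erase _ _ hmem, ← Finset.mul_prod_erase _ _ hmem]
  have hrest : ∏ p ∈ (Finset.univ.filter (fun p : Fin n × Fin n => p.1 < p.2)).erase (i, j),
        binomial τ ((σ * Equiv.swap i j) p.1) ((σ * Equiv.swap i j) p.2)
      = ∏ p ∈ (Finset.univ.filter (fun p : Fin n × Fin n => p.1 < p.2)).erase (i, j),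
        binomial τ (σ p.1) (σ p.2) := by
    refine Finset.prod_equiv ((Equiv.swap i j).prodCongr (Equiv.swap i j)) ?_ ?_
    · have key : ∀ p ∈ (Finset.univ.filter (fun p : Fin n × Fin n => p.1 < p.2)).erase (i, j),
          ((Equiv.swap i j).prodCongr (Equiv.swap i j)) p ∈
            (Finset.univ.filter (fun p : Fin n × Fin n => p.1 < p.2)).erase (i, j) := by
        rintro ⟨a, b⟩ hp
        simp only [Finset.mem_erase, Finset.mem_filter, Finset.mem_univ, true_and,
          Equiv.prodCongr_apply, Prod.map] at hp ⊢
        refine ⟨?_, swap_lt_swap_of_adjacent hij hp.2 hp.1⟩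
        rintro h
        have h1 : a = j := by simpa [Equiv.swap_apply_eq_iff] using congrArg Prod.fst h
        have h2 : b = i := by simpa [Equiv.swap_apply_eq_iff] using congrArg Prod.snd h
        subst h1 h2
        exact absurd hp.2 hlt.asymm
      intro p
      refine ⟨key p, fun h => ?_⟩
      have := key _ h
      simpa [Prod.map, ← Function.comp_def] using this
    · intro p _
      simp
  rw [hrest]
  simp only [Equiv.Perm.mul_apply, Equiv.swap_apply_left, Equiv.swap_apply_right]
  ring

theorem sum_sign_smul_eq_zero {A : Type*} [AddCommGroup A] (G : Equiv.Perm (Fin n) → A)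
    {i j : Fin n} (hij : i ≠ j) (hG : ∀ σ, G (σ * Equiv.swap i j) = G σ) :
    ∑ σ, ((Equiv.Perm.sign σ : ℤˣ) : ℤ) • G σ = 0 := by
  refine Finset.sum_involution (fun σ _ => σ * Equiv.swap i j) ?_ ?_ (by simp) ?_
  · intro σ _
    simp [hG, Equiv.Perm.sign_swap hij]
  · intro σ _ _ h
    exact hij (Equiv.swap_eq_one_iff.1 (mul_eq_left.1 h))
  · intro σ _
    simp [mul_assoc]

/-- The multiplier `x_{i+1} - τ x_i` supplies the reversed factor of the pair `(i, j)`, and `x^v +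
x^{v s_i}` is symmetric. The summand without its sign is therefore invariant under `σ ↦ σ s_i`, and
the signs cancel it. -/
theorem straightens_alternant {K : Type*} [Field K] (τ : K) :
    Straightens τ (alternant τ : (Fin n → ℤ) → AddMonoidAlgebra K (Fin n → ℤ)) := by
  intro v i j hij
  have hne : i ≠ j := by rintro rfl; omega
  have hsingle : ∀ (u : Fin n → ℤ) (k : Fin n) (σ : Equiv.Perm (Fin n)),
      single ((u + Pi.single k 1) ∘ σ.symm) (1 : K)
        = single (u ∘ σ.symm) 1 * single (Pi.single (σ k) 1) 1 := by
    intro u k σ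
    rw [single_mul_single, one_mul]
    congr 1
    funext l
    simp [Pi.single_apply, Equiv.symm_apply_eq]
  rw [← sum_sign_smul_eq_zero (fun σ => (single (v ∘ σ.symm) (1 : K)
      + single ((v ∘ Equiv.swap i j) ∘ σ.symm) 1) * (binomial τ (σ j) (σ i)
        * twistedVandermonde τ σ)) hne ?_]
  · unfold alternant
    rw [Finset.smul_sum, Finset.smul_sum, ← Finset.sum_add_distrib, ← Finset.sum_sub_distrib,
      ← Finset.sum_sub_distrib]
    refine Finset.sum_congr rfl fun σ _ => ?_
    rw [smul_comm τ, smul_comm τ, ← smul_add, ← smul_sub, ← smul_sub]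
    congr 1
    have hτ : single (Pi.single (σ i) 1 : Fin n → ℤ) τ = τ • single (Pi.single (σ i) 1) 1 := by
      simp
    rw [hsingle, hsingle, hsingle, hsingle, binomial, hτ]
    simp only [sub_mul, mul_sub, add_mul, smul_mul_assoc, mul_smul_comm, mul_assoc, smul_add]
    abel
  · intro σ
    rw [binomial_mul_twistedVandermonde_swap τ σ hij]
    congr 1
    have e1 : v ∘ (σ * Equiv.swap i j).symm = (v ∘ Equiv.swap i j) ∘ σ.symm := rfl
    have e2 : (v ∘ Equiv.swap i j) ∘ (σ * Equiv.swap i j).symm = v ∘ σ.symm := by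
      funext k
      simp [Equiv.Perm.mul_def]
    rw [e1, e2, add_comm]

theorem mapRingHom_alternant {S : Type*} [CommRing S] (φ : R →+* S) (τ : R) (v : Fin n → ℤ) :
    mapRingHom (Fin n → ℤ) φ (alternant τ v) = alternant (φ τ) v := by
  simp [alternant, twistedVandermonde, binomial, map_sum, map_prod]

theorem map_alternant_coeff {S : Type*} [CommRing S] (φ : R →+* S) (τ : R) (v w : Fin n → ℤ) :
    φ ((alternant τ v).coeff w) = (alternant (φ τ) v).coeff w := by
  rw [← mapRingHom_alternant, coeff_mapRingHom]

/-- The exponent `[n-1, …, 1, 0]`. -/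
def staircase (n : ℕ) : Fin n → ℤ := fun k => (n : ℤ) - 1 - k

theorem twistedVandermonde_zero (σ : Equiv.Perm (Fin n)) :
    twistedVandermonde (0 : R) σ = single (staircase n ∘ σ.symm) 1 := by
  have h : ∀ (P : Finset (Fin n × Fin n)),
      ∏ p ∈ P, binomial (0 : R) (σ p.1) (σ p.2)
        = single (∑ p ∈ P, Pi.single (σ p.1) 1) 1 := by
    intro P
    induction P using Finset.induction_on with
    | empty => simp [one_def]
    | insert p P hp ih =>
      rw [Finset.prod_insert hp, Finset.sum_insert hp, ih, binomial]
      simp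
  rw [twistedVandermonde, h]
  congr 1
  funext k
  rw [Finset.sum_apply]
  have : ∀ p : Fin n × Fin n, (Pi.single (σ p.1) (1 : ℤ) : Fin n → ℤ) k
      = if p.1 = σ.symm k then 1 else 0 := by
    intro p
    simp [Pi.single_apply, Equiv.eq_symm_apply, eq_comm]
  simp only [this]
  rw [Finset.sum_boole]
  have hcard : (Finset.univ.filter (fun p : Fin n × Fin n => p.1 < p.2)).filter
      (fun p => p.1 = σ.symm k) = (Finset.Ioi (σ.symm k)).map
        ⟨fun b => (σ.symm k, b), fun a b h => (Prod.mk.inj h).2⟩ := by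
    ext ⟨a, b⟩
    simp only [Finset.mem_filter, Finset.mem_univ, true_and, Finset.mem_map, Finset.mem_Ioi]
    constructor
    · rintro ⟨h1, rfl⟩
      exact ⟨b, h1, rfl⟩
    · rintro ⟨c, h1, h2⟩
      obtain ⟨rfl, rfl⟩ := Prod.mk.inj h2
      exact ⟨h1, rfl⟩
  rw [hcard, Finset.card_map, Fin.card_Ioi]
  have := (σ.symm k).2
  simp only [staircase, Function.comp]
  omega

/-- At `τ = 0` this is the ordinary alternant of `v + δ`, with `δ` the staircase. Since `v + δ` and
`w + δ` are strictly decreasing, only the identity permutation can carry one to the other. -/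
theorem alternant_zero_coeff {v w : Fin n → ℤ} (hv : Antitone v) (hw : Antitone w) :
    (alternant (0 : R) v).coeff (w + staircase n) = if v = w then 1 else 0 := by
  have hst : StrictAnti (staircase n) := by
    intro a b hab
    simp only [staircase]
    have := Fin.lt_def.1 hab
    omega
  have hstrict : ∀ u : Fin n → ℤ, Antitone u → StrictAnti (u + staircase n) :=
    fun u hu a b hab => add_lt_add_of_le_of_lt (hu hab.le) (hst hab)
  have hσ : ∀ σ : Equiv.Perm (Fin n), (v + staircase n) ∘ σ.symm = w + staircase n ↔
      σ = 1 ∧ v = w := by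
    intro σ
    constructor
    · intro h
      have hmono : StrictMono σ.symm := by
        intro a b hab
        have h1 := hstrict w hw hab
        rw [← h] at h1
        exact (hstrict v hv).lt_iff_gt.1 h1
      have h1 : ⇑σ.symm = id := (StrictMono.range_inj hmono strictMono_id).1 (by simp)
      rw [h1, Function.comp_id] at h
      refine ⟨Equiv.ext fun k => ?_, add_right_cancel h⟩
      have := congrFun h1 (σ k)
      simpa using this.symm
    · rintro ⟨rfl, rfl⟩
      rfl
  have hterm : ∀ σ : Equiv.Perm (Fin n), (((Equiv.Perm.sign σ : ℤˣ) : ℤ) •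
      (single (v ∘ σ.symm) (1 : R) * twistedVandermonde 0 σ)).coeff (w + staircase n)
      = if σ = 1 then (if v = w then 1 else 0) else 0 := by
    intro σ
    rw [twistedVandermonde_zero, single_mul_single, one_mul, coeff_smul, Finsupp.smul_apply,
      coeff_single, Finsupp.single_apply]
    have : v ∘ σ.symm + staircase n ∘ σ.symm = (v + staircase n) ∘ σ.symm := rfl
    rw [this, if_congr (hσ σ) rfl rfl]
    by_cases h : σ = 1
    · subst h; simp
    · simp [h]
  rw [alternant, coeff_sum, Finsupp.finsetSum_apply, Finset.sum_congr rfl fun σ _ => hterm σ]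
  simp

/-- For finitely many exponents, the matrix of coefficients at the staircase-shifted exponents is
the value at `t` of a matrix over `ℚ[X]` that is the identity at `X = 0`. Its determinant is a
nonzero polynomial, which a transcendental `t` does not annihilate. -/
theorem linearIndependent_alternant {K : Type*} [Field K] [CharZero K] {t : K}
    (ht : Transcendental ℚ t) :
    LinearIndependent K fun lam : {v : Fin n → ℤ // Antitone v} => alternant t lam.1 := by
  rw [linearIndependent_iff_finset_linearIndependent]
  intro s
  let c : Matrix s s (Polynomial ℚ) := fun a b =>
    (alternant (Polynomial.X : Polynomial ℚ) a.1.1).coeff (b.1.1 + staircase n)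
  have h0 : (Polynomial.evalRingHom (0 : ℚ)).mapMatrix c = 1 := by
    ext a b
    rw [RingHom.mapMatrix_apply, Matrix.map_apply, map_alternant_coeff,
      Polynomial.coe_evalRingHom, Polynomial.eval_X, alternant_zero_coeff a.1.2 b.1.2,
      Matrix.one_apply]
    simp only [Subtype.ext_iff]
  have hdet : c.det ≠ 0 := by
    intro h
    have := congrArg (Polynomial.evalRingHom (0 : ℚ)) h
    rw [RingHom.map_det, h0] at this
    simp at this
  have hdet' : (((Polynomial.aeval t : Polynomial ℚ →ₐ[ℚ] K) : Polynomial ℚ →+* K).mapMatrix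
      c).det ≠ 0 := by
    rw [← RingHom.map_det]
    exact fun h => hdet ((transcendental_iff.1 ht) _ h)
  have hli := Matrix.linearIndependent_rows_of_det_ne_zero hdet'
  refine LinearIndependent.of_comp
    (LinearMap.pi fun b : s => (Finsupp.lapply (b.1.1 + staircase n)).comp
      (coeffLinearEquiv K).toLinearMap) ?_
  convert hli using 1
  · funext a b
    refine Eq.trans ?_ (map_alternant_coeff
      ((Polynomial.aeval t : Polynomial ℚ →ₐ[ℚ] K) : Polynomial ℚ →+* K) Polynomial.X a.1.1
      (b.1.1 + staircase n)).symm
    simp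
  · rfl
  · rfl

end

/-! ### Dual functionals; existence and uniqueness of the form. -/

section

variable {K : Type*} [Field K] {n : ℕ} {t : K}

/-- The functional is the coordinate at `λ` along the independent alternants, extended to the whole
algebra and composed with `alternant`. -/
theorem exists_dual_straightens [CharZero K] (ht : Transcendental ℚ t) (lam : Part n) :
    ∃ φ : (Fin n → ℤ) → K, Straightens t φ ∧ (∀ v, ¬ TailNonneg v → φ v = 0) ∧
      ∀ mu : Part n, φ mu.exponent = if lam = mu then 1 else 0 := by
  have hanti : ∀ mu : Part n, Antitone mu.exponent := fun mu i j hij =>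
    Int.ofNat_le.2 (mu.2 hij)
  have hli := linearIndependent_alternant (n := n) ht
  obtain ⟨g, hg⟩ := LinearMap.exists_extend
    ((Finsupp.lapply (⟨lam.exponent, hanti lam⟩ : {v : Fin n → ℤ // Antitone v})).comp hli.repr)
  have hval : ∀ v (hv : Antitone v), g (alternant t v) = if lam.exponent = v then 1 else 0 := by
    intro v hv
    have h1 := LinearMap.congr_fun hg ⟨alternant t v, Submodule.subset_span ⟨⟨v, hv⟩, rfl⟩⟩
    have h2 := hli.repr_eq_single ⟨v, hv⟩
      ⟨alternant t v, Submodule.subset_span ⟨⟨v, hv⟩, rfl⟩⟩ rfl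
    rw [LinearMap.comp_apply, LinearMap.comp_apply, h2] at h1
    simpa [Finsupp.single_apply, eq_comm] using h1
  have hst : Straightens t fun v => g (alternant t v) := by
    intro v i j hij
    simp only [← map_add, ← map_sub, ← map_smul]
    rw [straightens_alternant t v i j hij, map_zero]
  refine ⟨fun v => g (alternant t v), hst, fun v hv => ?_, fun mu => ?_⟩
  -- Straightening never increases tail sums, so an exponent with a negative tail sum reduces to
  -- antitone ones of the same kind. None of those is a partition, and the target subspace can be
  -- `⊥`.
  · refine (Submodule.mem_bot K).1 (hst.mem_of_antitone ⊥ (fun v => ¬ TailNonneg v)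
      (fun v w hvw hv hw => hv fun k => (hw k).trans (hvw k)) (fun w hw hneg => ?_) v hv)
    rw [Submodule.mem_bot, hval w hw, if_neg]
    rintro rfl
    exact hneg fun k => Finset.sum_nonneg fun i _ => Int.natCast_nonneg _
  · simp only [hval _ (hanti mu)]
    refine if_congr ⟨fun h => Subtype.ext (funext fun i => ?_), fun h => h ▸ rfl⟩ rfl rfl
    simpa [Part.exponent] using congrFun h i

/-- A functional on exponents that vanishes outside the exponents with nonnegative tail sums,
extended to Laurent series. -/
noncomputable def seriesFunctional (φ : (Fin n → ℤ) → K) (hφ : ∀ v, ¬ TailNonneg v → φ v = 0) :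
    LaurentSeriesSpace K n →ₗ[K] K where
  toFun f := ∑ᶠ v, f.1 v * φ v
  map_add' f g := by
    have hfin : ∀ f : LaurentSeriesSpace K n, (Function.support fun v => f.1 v * φ v).Finite := by
      intro f
      refine Set.Finite.subset f.2 fun v hv => ⟨?_, left_ne_zero_of_mul hv⟩
      by_contra h
      exact hv (by simp [hφ v h])
    rw [← finsum_add_distrib (hfin f) (hfin g)]
    exact finsum_congr fun v => add_mul _ _ _
  map_smul' c f := by
    simp only [RingHom.id_apply, smul_eq_mul, mul_finsum]
    exact finsum_congr fun v => mul_assoc _ _ _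

theorem seriesFunctional_mono (φ : (Fin n → ℤ) → K) (hφ : ∀ v, ¬ TailNonneg v → φ v = 0)
    (v : Fin n → ℤ) : seriesFunctional φ hφ (mono K v) = φ v := by
  change ∑ᶠ w, (mono K v).1 w * φ w = φ v
  rw [finsum_eq_single _ v fun w hw => by rw [mono_apply, if_neg hw, zero_mul], mono_apply,
    if_pos rfl, one_mul]

theorem relations_le_ker_seriesFunctional (φ : (Fin n → ℤ) → K)
    (hφ : ∀ v, ¬ TailNonneg v → φ v = 0) (hs : Straightens t φ) :
    relations n t ≤ LinearMap.ker (seriesFunctional φ hφ) := by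
  refine Submodule.span_le.2 ?_
  rintro f ((⟨v, i, j, hij, rfl⟩ | ⟨v, hv, rfl⟩) | hf)
  · simp only [SetLike.mem_coe, LinearMap.mem_ker, map_add, map_sub, map_smul,
      seriesFunctional_mono]
    exact hs v i j hij
  · simp only [SetLike.mem_coe, LinearMap.mem_ker, seriesFunctional_mono]
    exact hφ v hv.not_tailNonneg
  · change ∑ᶠ w, f.1 w * φ w = 0
    rw [finsum_eq_zero_of_forall_eq_zero]
    intro w
    by_cases hw : TailNonneg w
    · rw [hf w hw, zero_mul]
    · rw [hφ w hw, mul_zero]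

theorem linearIndependent_cls_part [CharZero K] (ht : Transcendental ℚ t) :
    LinearIndependent K fun lam : Part n => cls t (mono K lam.exponent) := by
  choose φ h1 h2 h3 using fun lam : Part n => exists_dual_straightens ht lam
  let f : Part n → Module.Dual K (Straightened n t) := fun lam =>
    (relations n t).liftQ (seriesFunctional (φ lam) (h2 lam))
      (relations_le_ker_seriesFunctional _ _ (h1 lam))
  have hf : ∀ lam mu : Part n, f lam (cls t (mono K mu.exponent)) = if lam = mu then 1 else 0 := by
    intro lam mu
    rw [← h3 lam mu]
    exact ((relations n t).liftQ_apply _ _).trans (seriesFunctional_mono _ _ _)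
  exact LinearIndependent.of_pairwise_dual_eq_zero_one _ f
    (fun lam mu hne => (hf lam mu).trans (if_neg hne)) (fun lam => (hf lam lam).trans (if_pos rfl))

theorem existsUnique_isScalarProduct [CharZero K] (ht : Transcendental ℚ t) :
    ∃! B : LinearMap.BilinForm K (Straightened n t), IsScalarProduct t B := by
  let e := Module.Basis.mk (linearIndependent_cls_part (n := n) ht) (span_cls_part t).ge
  have he : ∀ lam, e lam = cls t (mono K lam.exponent) := fun lam =>
    Module.Basis.mk_apply _ _ _
  refine ⟨e.constr K fun lam => lam.b t • e.coord lam, ?_, ?_⟩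
  · intro lam mu
    rw [← he, ← he, e.constr_basis]
    simp [Finsupp.single_apply, eq_comm]
  · intro B hB
    refine e.ext fun lam => e.ext fun mu => ?_
    rw [e.constr_basis, he, he, hB, ← he mu]
    simp [Finsupp.single_apply, eq_comm]

end

/-! ### Classes of the geometric series. -/

section

variable {K : Type*} [Field K] {n : ℕ}

/-- Lower the coordinates in `S` by one. -/
def lower (S : Finset (Fin n)) (v : Fin n → ℤ) : Fin n → ℤ :=
  fun i => v i - if i ∈ S then 1 else 0

theorem sum_lower (S : Finset (Fin n)) (v : Fin n → ℤ) :
    ∑ i, lower S v i = ∑ i, v i - S.card := by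
  simp [lower, Finset.sum_sub_distrib]

theorem lower_empty (v : Fin n → ℤ) : lower ∅ v = v := by
  funext i
  simp [lower]

theorem mono_eq_sum_geom (c : K) (v : Fin n → ℤ) :
    mono K v = ∑ S : Finset (Fin n), (-c) ^ S.card • geom c (lower S v) := by
  apply Subtype.ext
  funext w
  rw [← geom_mul_denominator c v w, Submodule.coe_sum, Finset.sum_apply]
  refine Finset.sum_congr rfl fun S _ => ?_
  change _ = (-c) ^ S.card * geomCoeff c (lower S v) w
  congr 1
  change geomCoeff c v _ = _
  unfold geomCoeff
  refine Finset.prod_congr rfl fun i _ => ?_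
  simp only [lower]
  refine if_congr (by omega) ?_ rfl
  congr 2
  ring

/-- A term `v - u` with nonnegative tail sums has `u i ≤ ∑ u ≤ ∑ v < M`. The truncation is a cube so
that permuting coordinates acts on the index set. -/
theorem cls_geom_eq_sum (t c : K) (v : Fin n → ℤ) {M : ℕ} (hM : ∑ i, v i < M) :
    cls t (geom c v) = ∑ u : Fin n → Fin M,
      c ^ (∑ i, (u i : ℕ)) • cls t (mono K (v - fun i => ((u i : ℕ) : ℤ))) := by
  have hinj : Function.Injective fun (u : Fin n → Fin M) => v - fun i => ((u i : ℕ) : ℤ) := by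
    intro u u' h
    funext i
    have := congrFun (sub_right_injective h) i
    exact Fin.ext (by exact_mod_cast this)
  rw [cls_eq_sum t (geom c v) (Finset.univ.image fun (u : Fin n → Fin M) =>
    v - fun i => ((u i : ℕ) : ℤ)) ?_, Finset.sum_image hinj.injOn]
  · refine Finset.sum_congr rfl fun u _ => ?_
    congr 1
    change geomCoeff c v _ = _
    unfold geomCoeff
    rw [← Finset.prod_pow_eq_pow_sum]
    refine Finset.prod_congr rfl fun i _ => ?_
    rw [Pi.sub_apply, if_pos (by omega)]
    congr 1
    omega
  · intro w hw hne
    have hle : ∀ i, w i ≤ v i := by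
      intro i
      by_contra h
      exact hne (Finset.prod_eq_zero (Finset.mem_univ i) (if_neg h))
    have hlt : ∀ i, v i - w i < M := by
      intro i
      have h0 : 0 ≤ ∑ j, w j := by
        have := hw ⟨0, i.pos⟩
        rwa [show Finset.Ici (⟨0, i.pos⟩ : Fin n) = Finset.univ by
          ext j; simp [Fin.le_def]] at this
      have h1 := Finset.single_le_sum (f := fun j => v j - w j)
        (fun j _ => sub_nonneg.2 (hle j)) (Finset.mem_univ i)
      rw [Finset.sum_sub_distrib] at h1
      omega
    refine Finset.mem_image.2 ⟨fun i => ⟨(v i - w i).toNat, ?_⟩, Finset.mem_univ _, ?_⟩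
    · have := hlt i
      have := hle i
      omega
    · funext i
      have := hle i
      simp only [Pi.sub_apply]
      omega

theorem cls_geom_eq_zero (t c : K) {v : Fin n → ℤ} (hv : LastNeg v) : cls t (geom c v) = 0 := by
  refine cls_eq_zero_of_tailNonneg t fun w hw => ?_
  obtain ⟨i, hi, hneg⟩ := hv
  by_contra hne
  refine LastNeg.not_tailNonneg ⟨i, hi, lt_of_le_of_lt ?_ hneg⟩ hw
  by_contra h
  exact hne (Finset.prod_eq_zero (Finset.mem_univ i) (if_neg h))

/-- Here `v = y + e_j` with `y` fixed by the swap, and `∏ (1 - c/x_i)⁻¹` is symmetric. Summing the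
relations at `y - u` over the cube of all `u` gives each side twice. -/
theorem cls_geom_of_succ [CharZero K] (t c : K) (v : Fin n → ℤ) {i j : Fin n}
    (hij : (i : ℕ) + 1 = j) (hv : v j = v i + 1) :
    cls t (geom c v) = t • cls t (geom c (v ∘ Equiv.swap i j)) := by
  have hne : i ≠ j := by rintro rfl; omega
  set M := (∑ k, v k).toNat + 1 with hMdef
  have hM : ∑ k, v k < M := by omega
  have hM' : ∑ k, (v ∘ Equiv.swap i j) k < M := by
    simpa [Equiv.sum_comp (Equiv.swap i j) v] using hM
  rw [cls_geom_eq_sum t c v hM, cls_geom_eq_sum t c _ hM', Finset.smul_sum]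
  set y : Fin n → ℤ := v - Pi.single j 1 with hy
  have hys : y ∘ Equiv.swap i j = y := by
    funext k
    rcases eq_or_ne k i with rfl | hi
    · simp [hy, hne, hv]
    · rcases eq_or_ne k j with rfl | hj
      · simp [hy, hne, hv]
      · simp [hy, hi, hj, Equiv.swap_apply_of_ne_of_ne]
  have h1 : v = y + Pi.single j 1 := by simp [hy]
  have h2 : v ∘ Equiv.swap i j = y + Pi.single i 1 := by
    rw [← shift_eq_comp_swap v hne, hv, hy, shift]
    simp
    abel
  let a : (Fin n → Fin M) → Fin n → Straightened n t := fun u k =>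
    c ^ (∑ i, (u i : ℕ)) • cls t (mono K (y - (fun i => ((u i : ℕ) : ℤ)) + Pi.single k 1))
  have hrel : ∀ u, a u j + a (u ∘ Equiv.swap i j) j = t • a u i + t • a (u ∘ Equiv.swap i j) i := by
    intro u
    have h := straightens_cls_mono t (y - fun i => ((u i : ℕ) : ℤ)) i j hij
    have e : (y - fun i => ((u i : ℕ) : ℤ)) ∘ Equiv.swap i j
        = y - fun k => (((u ∘ Equiv.swap i j) k : ℕ) : ℤ) := by
      conv_rhs => rw [← hys]
      rfl
    have hsum : ∑ k, ((u ∘ Equiv.swap i j) k : ℕ) = ∑ k, (u k : ℕ) :=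
      Equiv.sum_comp (Equiv.swap i j) fun k => (u k : ℕ)
    rw [e] at h
    simp only [a, hsum]
    rw [smul_comm t, smul_comm t, ← smul_add, ← smul_add]
    congr 1
    rw [← sub_eq_zero, ← h]
    abel
  have hcomp : ∀ k, ∑ u, a (u ∘ Equiv.swap i j) k = ∑ u, a u k := fun k =>
    Equiv.sum_comp ((Equiv.swap i j).arrowCongr (Equiv.refl (Fin M))) fun u => a u k
  have hsum := Finset.sum_congr (rfl : (Finset.univ : Finset (Fin n → Fin M)) = _)
    fun u _ => hrel u
  simp only [Finset.sum_add_distrib, ← Finset.smul_sum, hcomp] at hsum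
  rw [← two_smul K, ← two_smul K (t • _)] at hsum
  have := smul_right_injective (Straightened n t) (two_ne_zero (α := K)) hsum
  rw [← Finset.smul_sum, h2]
  have e1 : ∀ u : Fin n → Fin M, v - (fun i => ((u i : ℕ) : ℤ))
      = y - (fun i => ((u i : ℕ) : ℤ)) + Pi.single j 1 := by
    intro u
    rw [h1, add_sub_right_comm]
  simp only [e1, add_sub_right_comm y (Pi.single i (1 : ℤ))]
  exact this

end

/-! ### The explicit extension of `θ` and its alternating sums. -/

section

variable {n : ℕ}

/-- The number of coordinates that are at least `k`. -/
def countGE (w : Fin n → ℤ) (k : ℤ) : ℕ := (Finset.univ.filter fun j => k ≤ w j).card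

theorem lt_countGE_iff {v : Fin n → ℤ} (hv : Antitone v) (k : ℤ) (i : Fin n) :
    (i : ℕ) < countGE v k ↔ k ≤ v i := by
  constructor
  · intro h
    by_contra hk
    have hsub : (Finset.univ.filter fun j => k ≤ v j) ⊆ Finset.Iio i := by
      intro j hj
      rw [Finset.mem_Iio]
      by_contra hji
      exact hk ((Finset.mem_filter.1 hj).2.trans (hv (not_lt.1 hji)))
    have := Finset.card_le_card hsub
    rw [Fin.card_Iio] at this
    exact absurd h (not_lt.2 this)
  · intro h
    have hsub : Finset.Iic i ⊆ Finset.univ.filter fun j => k ≤ v j := fun j hj =>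
      Finset.mem_filter.2 ⟨Finset.mem_univ _, h.trans (hv (Finset.mem_Iic.1 hj))⟩
    have := Finset.card_le_card hsub
    rw [Fin.card_Iic] at this
    exact this

theorem countGE_le (v : Fin n → ℤ) (k : ℤ) : countGE v k ≤ n :=
  (Finset.card_le_univ _).trans_eq (Fintype.card_fin n)

theorem countGE_mono {v w : Fin n → ℤ} {k l : ℤ} (h : ∀ i, k ≤ v i → l ≤ w i) :
    countGE v k ≤ countGE w l :=
  Finset.card_le_card fun i hi =>
    Finset.mem_filter.2 ⟨Finset.mem_univ _, h i (Finset.mem_filter.1 hi).2⟩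

theorem countGE_eq_sum (v : Fin n → ℤ) (k : ℤ) :
    (countGE v k : ℤ) = ∑ i, if k ≤ v i then 1 else 0 := by
  simp [countGE]

/-- The exponent `n(λ) + n(μ) - ∑_{i,j} min(λ_i, μ_j)`. -/
def pairingExponent (v w : Fin n → ℤ) : ℤ :=
  ∑ i : Fin n, (i : ℤ) * v i + ∑ j : Fin n, (j : ℤ) * w j - ∑ i, ∑ j, min (v i) (w j)

end

section

variable {K : Type*} [Field K] {n : ℕ}

/-- The extension of `θ` to exponents in `ℤⁿ` by the formula `t^(n(v) + n(w) - ∑ min(v_i, w_j))`,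
and by zero where a coordinate is negative. -/
def pairing (t : K) (v w : Fin n → ℤ) : K :=
  if (∀ i, 0 ≤ v i) ∧ ∀ j, 0 ≤ w j then t ^ pairingExponent v w else 0

theorem pairing_comm (t : K) (v w : Fin n → ℤ) : pairing t v w = pairing t w v := by
  unfold pairing
  refine if_congr and_comm ?_ rfl
  congr 1
  unfold pairingExponent
  rw [Finset.sum_comm]
  simp only [min_comm]
  ring

/-- The sum of minima is symmetric in the coordinates of `v`, while `∑ k * v k` drops by one under
the swap. -/
theorem pairing_of_succ {t : K} (ht : t ≠ 0) (v w : Fin n → ℤ) {i j : Fin n}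
    (hij : (i : ℕ) + 1 = j) (hv : v j = v i + 1) :
    pairing t v w = t * pairing t (v ∘ Equiv.swap i j) w := by
  have hne : i ≠ j := by rintro rfl; omega
  have h1 : (∀ k, 0 ≤ v k) ↔ ∀ k, 0 ≤ (v ∘ Equiv.swap i j) k :=
    ((Equiv.swap i j).forall_congr_right (q := fun k => 0 ≤ v k)).symm
  have h2 : pairingExponent v w = pairingExponent (v ∘ Equiv.swap i j) w + 1 := by
    have e1 : ∑ k, ∑ l, min ((v ∘ Equiv.swap i j) k) (w l) = ∑ k, ∑ l, min (v k) (w l) :=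
      Equiv.sum_comp (Equiv.swap i j) fun k => ∑ l, min (v k) (w l)
    have e2 : ∑ k : Fin n, (k : ℤ) * (v ∘ Equiv.swap i j) k = ∑ k : Fin n, (k : ℤ) * v k - 1 := by
      rw [← shift_eq_comp_swap v hne, sum_shift_mul v (fun k => (k : ℤ)), hv, ← hij]
      push_cast
      ring
    unfold pairingExponent
    rw [e1, e2]
    ring
  unfold pairing
  by_cases h : (∀ k, 0 ≤ v k) ∧ ∀ l, 0 ≤ w l
  · rw [if_pos h, if_pos ⟨h1.1 h.1, h.2⟩, h2, zpow_add_one₀ ht, mul_comm]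
  · rw [if_neg h, if_neg fun h' => h ⟨h1.2 h'.1, h'.2⟩, mul_zero]

theorem pairing_eq_zero (t : K) {v : Fin n → ℤ} (hv : LastNeg v) (w : Fin n → ℤ) :
    pairing t v w = 0 := by
  obtain ⟨i, -, hi⟩ := hv
  exact if_neg fun h => absurd (h.1 i) (not_le.2 hi)

/-- The factor of `pairing t v w` that depends on the coordinate `v i = a`. -/
def pairingFactor (t : K) (w : Fin n → ℤ) (i : Fin n) (a : ℤ) : K :=
  if 0 ≤ a then t ^ ((i : ℤ) * a - ∑ j, min a (w j)) else 0

theorem zpow_sum {t : K} (ht : t ≠ 0) (f : Fin n → ℤ) : t ^ (∑ i, f i) = ∏ i, t ^ f i := by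
  induction (Finset.univ : Finset (Fin n)) using Finset.induction_on with
  | empty => simp
  | insert i s hi ih => rw [Finset.sum_insert hi, Finset.prod_insert hi, zpow_add₀ ht, ih]

theorem pairing_eq_prod {t : K} (ht : t ≠ 0) (v : Fin n → ℤ) {w : Fin n → ℤ}
    (hw : ∀ j, 0 ≤ w j) :
    pairing t v w = t ^ (∑ j : Fin n, (j : ℤ) * w j) * ∏ i, pairingFactor t w i (v i) := by
  unfold pairing
  by_cases hv : ∀ i, 0 ≤ v i
  · rw [if_pos ⟨hv, hw⟩]
    simp only [pairingFactor, hv, if_true]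
    rw [← zpow_sum ht, ← zpow_add₀ ht, Finset.sum_sub_distrib]
    congr 1
    unfold pairingExponent
    ring
  · rw [if_neg fun h => hv h.1]
    push Not at hv
    obtain ⟨i, hi⟩ := hv
    rw [Finset.prod_eq_zero (Finset.mem_univ i), mul_zero]
    exact if_neg (not_le.2 hi)

theorem sum_pairing_lower {t : K} (ht : t ≠ 0) (v : Fin n → ℤ) {w : Fin n → ℤ}
    (hw : ∀ j, 0 ≤ w j) :
    ∑ S : Finset (Fin n), (-1) ^ S.card * pairing t (lower S v) w
      = t ^ (∑ j : Fin n, (j : ℤ) * w j)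
        * ∏ i, (pairingFactor t w i (v i) - pairingFactor t w i (v i - 1)) := by
  have h : ∀ i, pairingFactor t w i (v i) - pairingFactor t w i (v i - 1)
      = -pairingFactor t w i (v i - 1) + pairingFactor t w i (v i) := fun i => by ring
  simp only [h]
  rw [Fintype.prod_add, Finset.mul_sum]
  refine Finset.sum_congr rfl fun S _ => ?_
  rw [pairing_eq_prod ht _ hw, mul_left_comm, ← Finset.prod_mul_prod_compl S, Finset.prod_neg,
    mul_assoc]
  congr 3
  · exact Finset.prod_congr rfl fun i hi => by simp [lower, hi]
  · exact Finset.prod_congr rfl fun i hi => by simp [lower, Finset.mem_compl.1 hi]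

/-- Lowering `a` to `a - 1` lowers `min a (w j)` exactly when `a ≤ w j`. At `a = 0` the lowered
factor is zero by definition, which gives the second branch. -/
theorem pairingFactor_sub {t : K} (ht : t ≠ 0) (w : Fin n → ℤ) (i : Fin n)
    {a : ℤ} (ha : 0 ≤ a) :
    pairingFactor t w i a - pairingFactor t w i (a - 1)
      = pairingFactor t w i a * if 1 ≤ a then 1 - t ^ ((countGE w a : ℤ) - i) else 1 := by
  unfold pairingFactor
  split_ifs with h1 h2
  · rw [mul_one_sub, ← zpow_add₀ ht]
    congr 2
    have : ∑ j, min (a - 1) (w j) = ∑ j, min a (w j) - countGE w a := by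
      rw [countGE_eq_sum, ← Finset.sum_sub_distrib]
      refine Finset.sum_congr rfl fun j _ => ?_
      split_ifs <;> omega
    rw [this]
    ring
  · omega
  · omega
  · simp

/-- The two inequalities say that the row with zero-based index `countGE w k` has `v i = k`. Its
factor in the product is `1 - t^0`. -/
theorem sum_pairing_lower_eq_zero {t : K} (ht : t ≠ 0) {v w : Fin n → ℤ} (hv : Antitone v)
    (hv0 : ∀ i, 0 ≤ v i) (hw : ∀ j, 0 ≤ w j) {k : ℤ} (hk : 1 ≤ k)
    (h1 : countGE v (k + 1) ≤ countGE w k) (h2 : countGE w k < countGE v k) :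
    ∑ S : Finset (Fin n), (-1) ^ S.card * pairing t (lower S v) w = 0 := by
  let i : Fin n := ⟨countGE w k, h2.trans_le (countGE_le v k)⟩
  have hi1 : k ≤ v i := (lt_countGE_iff hv k i).1 h2
  have hi2 : ¬ k + 1 ≤ v i := fun h => absurd ((lt_countGE_iff hv _ i).2 h) (not_lt.2 h1)
  have hi : v i = k := by omega
  rw [sum_pairing_lower ht v hw, Finset.prod_eq_zero (Finset.mem_univ i), mul_zero]
  rw [pairingFactor_sub ht w i (hv0 i), hi, if_pos hk]
  simp [i]

theorem pairing_of_not_nonneg (t : K) (v : Fin n → ℤ) {w : Fin n → ℤ} (hw : ¬ ∀ j, 0 ≤ w j) :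
    pairing t v w = 0 :=
  if_neg fun h => hw h.2

theorem lower_le (T : Finset (Fin n)) (v : Fin n → ℤ) (i : Fin n) : lower T v i ≤ v i := by
  simp only [lower]; split_ifs <;> omega

theorem countGE_succ_le_lower (T : Finset (Fin n)) (v : Fin n → ℤ) (k : ℤ) :
    countGE v (k + 1) ≤ countGE (lower T v) k :=
  countGE_mono fun i hi => by simp only [lower]; split_ifs <;> omega

/-- The alternating sum vanishes if `λ` exceeds `μ` at the first place where they differ. -/
theorem sum_pairing_lower_eq_zero_of_lt {t : K} (ht : t ≠ 0) {v w : Fin n → ℤ} (hv : Antitone v)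
    (hv0 : ∀ i, 0 ≤ v i) (hw : Antitone w) (hw0 : ∀ i, 0 ≤ w i) {j : Fin n}
    (hj : ∀ i < j, v i = w i) (hlt : w j < v j) (T : Finset (Fin n)) :
    ∑ S : Finset (Fin n), (-1) ^ S.card * pairing t (lower S v) (lower T w) = 0 := by
  by_cases hT : ∀ i, 0 ≤ lower T w i
  · have := hw0 j
    refine sum_pairing_lower_eq_zero ht hv hv0 hT (k := v j) (by omega) ?_ ?_
    · refine (countGE_mono fun i hi => ?_).trans (countGE_succ_le_lower T w (v j))
      have hij : i < j := by
        by_contra h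
        have := hv (not_lt.1 h)
        omega
      rwa [← hj i hij]
    · refine lt_of_le_of_lt (countGE_mono (w := w) (l := v j) fun i hi =>
        hi.trans (lower_le T w i)) ?_
      refine lt_of_le_of_lt ?_ ((lt_countGE_iff hv (v j) j).2 le_rfl)
      by_contra h
      have := (lt_countGE_iff hw (v j) j).1 (not_le.1 h)
      omega
  · exact Finset.sum_eq_zero fun S _ => by rw [pairing_of_not_nonneg t _ hT, mul_zero]

theorem sum_pairing_lower_eq_zero_of_nonempty {t : K} (ht : t ≠ 0) {v : Fin n → ℤ}
    (hv : Antitone v) (hv0 : ∀ i, 0 ≤ v i) {T : Finset (Fin n)} (hT : T.Nonempty) :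
    ∑ S : Finset (Fin n), (-1) ^ S.card * pairing t (lower S v) (lower T v) = 0 := by
  obtain ⟨j, hj⟩ := hT
  by_cases hT : ∀ i, 0 ≤ lower T v i
  · have h0 := hT j
    have hlt : lower T v j < v j := by simp [lower, hj]
    -- At height `k = v j` the count drops strictly, since the coordinate `j ∈ T` falls below `k`.
    refine sum_pairing_lower_eq_zero ht hv hv0 hT (k := v j) (by omega)
      (countGE_succ_le_lower T v _) ?_
    refine Finset.card_lt_card (Finset.ssubset_iff_of_subset (fun i hi => ?_) |>.2 ⟨j, ?_, ?_⟩)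
    · exact Finset.mem_filter.2 ⟨Finset.mem_univ _,
        (Finset.mem_filter.1 hi).2.trans (lower_le T v i)⟩
    · simp
    · simpa using hlt
  · exact Finset.sum_eq_zero fun S _ => by rw [pairing_of_not_nonneg t _ hT, mul_zero]

end

/-! ### Conjugate partitions, `b_λ`, and the Gram matrix. -/

section

variable {n : ℕ}

theorem Part.antitone_exponent (lam : Part n) : Antitone lam.exponent := fun _ _ hij =>
  Int.ofNat_le.2 (lam.2 hij)

theorem Part.exponent_nonneg (lam : Part n) (i : Fin n) : 0 ≤ lam.exponent i :=
  Int.natCast_nonneg _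

theorem Part.sum_exponent (lam : Part n) : ∑ i, lam.exponent i = lam.size := by
  simp [Part.exponent, Part.size]

theorem Part.le_size (lam : Part n) (i : Fin n) : lam.1 i ≤ lam.size :=
  Finset.single_le_sum (f := lam.1) (fun _ _ => Nat.zero_le _) (Finset.mem_univ i)

theorem Part.countGE_exponent (lam : Part n) (k : ℕ) : countGE lam.exponent k = lam.conj k := by
  simp [countGE, Part.exponent, Part.conj]

theorem Part.conj_eq_sum (lam : Part n) (k : ℕ) :
    (lam.conj k : ℤ) = ∑ i, if k ≤ lam.1 i then 1 else 0 := by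
  simp [Part.conj]

theorem Part.lt_conj_iff (lam : Part n) (k : ℕ) (i : Fin n) :
    (i : ℕ) < lam.conj k ↔ k ≤ lam.1 i := by
  rw [← Part.countGE_exponent, lt_countGE_iff lam.antitone_exponent]
  exact Int.ofNat_le

theorem Part.conj_le (lam : Part n) (k : ℕ) : lam.conj k ≤ n :=
  (Finset.card_le_univ _).trans_eq (Fintype.card_fin n)

theorem two_mul_sum_lt {c : ℕ} (hc : c ≤ n) :
    2 * ∑ i : Fin n, (i : ℤ) * (if (i : ℕ) < c then 1 else 0) = c * (c - 1) := by
  rw [Fin.sum_univ_eq_sum_range fun i => (i : ℤ) * if i < c then 1 else 0]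
  simp only [mul_ite, mul_one, mul_zero]
  rw [← Finset.sum_filter]
  have : (Finset.range n).filter (· < c) = Finset.range c := by
    ext i
    simp only [Finset.mem_filter, Finset.mem_range]
    omega
  rw [this]
  induction c with
  | zero => simp
  | succ c ih =>
    rw [Finset.sum_range_succ, mul_add, ih (by omega)]
    · push_cast; ring
    · ext i
      simp only [Finset.mem_filter, Finset.mem_range]
      omega

theorem Part.two_mul_sum_index (lam : Part n) (k : ℕ) :
    2 * ∑ i : Fin n, (i : ℤ) * (if k ≤ lam.1 i then 1 else 0)
      = lam.conj k * (lam.conj k - 1) := by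
  rw [← two_mul_sum_lt (lam.conj_le k)]
  simp only [lam.lt_conj_iff]

theorem sum_Icc_indicator {a N : ℕ} (h : a ≤ N) :
    ∑ k ∈ Finset.Icc 1 N, (if k ≤ a then (1 : ℤ) else 0) = a := by
  rw [Finset.sum_boole]
  have : (Finset.Icc 1 N).filter (· ≤ a) = Finset.Icc 1 a := by
    ext k
    simp only [Finset.mem_filter, Finset.mem_Icc]
    omega
  rw [this, Nat.card_Icc, Nat.add_sub_cancel]

/-- Summing by columns, `∑ min(λ_i, μ_j)` becomes `∑ λ~_k μ~_k`, and `∑ i λ_i` with zero-based `i`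
becomes `∑ C(λ~_k, 2)`. The rest is `C(a - b, 2) = C(a, 2) + C(b, 2) - ab + b`, whose last term sums
to `|μ|`. -/
theorem Part.pairingExponent_eq (lam mu : Part n) :
    pairingExponent lam.exponent mu.exponent = lam.nSkew mu - mu.size := by
  have hterm : ∀ k : ℕ,
      ((lam.conj k : ℤ) - mu.conj k) * ((lam.conj k : ℤ) - mu.conj k - 1) / 2
        = ∑ i : Fin n, (i : ℤ) * (if k ≤ lam.1 i then 1 else 0)
          + ∑ i : Fin n, (i : ℤ) * (if k ≤ mu.1 i then 1 else 0)
          - ∑ i, ∑ j, (if k ≤ min (lam.1 i) (mu.1 j) then 1 else 0)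
          + ∑ i, if k ≤ mu.1 i then 1 else 0 := by
    intro k
    have hprod : ∑ i, ∑ j, (if k ≤ min (lam.1 i) (mu.1 j) then (1 : ℤ) else 0)
        = lam.conj k * mu.conj k := by
      rw [lam.conj_eq_sum, mu.conj_eq_sum, Finset.sum_mul_sum]
      refine Finset.sum_congr rfl fun i _ => Finset.sum_congr rfl fun j _ => ?_
      simp only [le_min_iff, ite_and, mul_ite, mul_one, mul_zero]
      split_ifs <;> rfl
    rw [hprod, ← mu.conj_eq_sum]
    apply Int.ediv_eq_of_eq_mul_right two_ne_zero
    linear_combination -lam.two_mul_sum_index k - mu.two_mul_sum_index k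
  unfold Part.nSkew
  rw [Finset.sum_congr rfl fun k _ => hterm k]
  simp only [Finset.sum_add_distrib, Finset.sum_sub_distrib]
  have hl : ∀ i, lam.1 i ≤ lam.size + mu.size := fun i => (lam.le_size i).trans (by omega)
  have hm : ∀ i, mu.1 i ≤ lam.size + mu.size := fun i => (mu.le_size i).trans (by omega)
  have h1 : ∀ nu : Part n, (∀ i, nu.1 i ≤ lam.size + mu.size) →
      ∑ k ∈ Finset.Icc 1 (lam.size + mu.size),
        ∑ i : Fin n, (i : ℤ) * (if k ≤ nu.1 i then 1 else 0)
        = ∑ i : Fin n, (i : ℤ) * nu.exponent i := by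
    intro nu hnu
    rw [Finset.sum_comm]
    refine Finset.sum_congr rfl fun i _ => ?_
    rw [← Finset.mul_sum, sum_Icc_indicator (hnu i)]
    rfl
  have h2 : ∑ k ∈ Finset.Icc 1 (lam.size + mu.size),
        ∑ i, ∑ j, (if k ≤ min (lam.1 i) (mu.1 j) then (1 : ℤ) else 0)
        = ∑ i, ∑ j, min (lam.exponent i) (mu.exponent j) := by
    rw [Finset.sum_comm]
    refine Finset.sum_congr rfl fun i _ => ?_
    rw [Finset.sum_comm]
    refine Finset.sum_congr rfl fun j _ => ?_
    rw [sum_Icc_indicator ((min_le_left _ _).trans (hl i))]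
    simp [Part.exponent]
  have h3 : ∑ k ∈ Finset.Icc 1 (lam.size + mu.size), ∑ i, (if k ≤ mu.1 i then (1 : ℤ) else 0)
      = mu.size := by
    rw [Finset.sum_comm, ← mu.sum_exponent]
    exact Finset.sum_congr rfl fun i _ => sum_Icc_indicator (hm i)
  rw [h1 lam hl, h1 mu hm, h2, h3]
  unfold pairingExponent
  ring

theorem Part.pairing_eq_theta {K : Type*} [Field K] (t : K) (lam mu : Part n) :
    pairing t lam.exponent mu.exponent = lam.theta t mu := by
  unfold pairing Part.theta
  rw [if_pos ⟨lam.exponent_nonneg, mu.exponent_nonneg⟩, lam.pairingExponent_eq]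

theorem Part.nSkew_self (lam : Part n) : lam.nSkew lam = 0 := by
  simp [Part.nSkew]

theorem Part.mult_add_conj (lam : Part n) (k : ℕ) :
    lam.mult k + lam.conj (k + 1) = lam.conj k := by
  unfold Part.mult Part.conj
  rw [← Finset.card_union_of_disjoint]
  · congr 1
    ext i
    simp only [Finset.mem_union, Finset.mem_filter, Finset.mem_univ, true_and]
    omega
  · rw [Finset.disjoint_filter]
    intro i _ h
    omega

/-- The rows with `λ_i = k` are those with `λ~_{k+1} ≤ i < λ~_k`, so `λ~_k - i` runs over `1, …,
m_k`. -/
theorem Part.prod_eq_b {K : Type*} [Field K] (t : K) (lam : Part n) :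
    ∏ i, (if 1 ≤ lam.exponent i
      then 1 - t ^ ((countGE lam.exponent (lam.exponent i) : ℤ) - (i : ℕ)) else 1) = lam.b t := by
  rw [← Finset.prod_filter, ← Finset.prod_fiberwise_of_maps_to (t := Finset.Icc 1 lam.size)
    (g := lam.1)]
  · unfold Part.b
    refine Finset.prod_congr rfl fun k hk => ?_
    rw [Finset.mem_Icc] at hk
    have hmc := lam.mult_add_conj k
    have hmem : ∀ i, i ∈ (Finset.univ.filter fun i => 1 ≤ lam.exponent i).filter
        (fun i => lam.1 i = k) ↔ lam.1 i = k := by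
      intro i
      rw [Finset.mem_filter, Finset.mem_filter]
      simp only [Finset.mem_univ, true_and, Part.exponent]
      omega
    refine Finset.prod_bij (fun i _ => lam.conj k - (i : ℕ)) ?_ ?_ ?_ ?_
    · intro i hi
      rw [hmem] at hi
      have h1 := (lam.lt_conj_iff k i).2 hi.ge
      have h2 := (lam.lt_conj_iff (k + 1) i).not.2 (by omega)
      rw [Finset.mem_Icc]
      omega
    · intro i hi i' hi' h
      rw [hmem] at hi hi'
      have h1 := (lam.lt_conj_iff k i).2 hi.ge
      have h2 := (lam.lt_conj_iff k i').2 hi'.ge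
      apply Fin.ext
      omega
    · intro j hj
      rw [Finset.mem_Icc] at hj
      have hle := lam.conj_le k
      let i : Fin n := ⟨lam.conj k - j, by omega⟩
      have h1 := (lam.lt_conj_iff k i).1 (by simp only [i]; omega)
      have h2 := (lam.lt_conj_iff (k + 1) i).not.1 (by simp only [i]; omega)
      refine ⟨i, (hmem i).2 (by omega), ?_⟩
      simp only [i]
      omega
    · intro i hi
      rw [hmem] at hi
      have h1 := (lam.lt_conj_iff k i).2 hi.ge
      have : lam.exponent i = (k : ℕ) := by simp [Part.exponent, hi]
      rw [this, lam.countGE_exponent, ← zpow_natCast, Nat.cast_sub h1.le]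
  · intro i hi
    rw [Finset.mem_filter] at hi
    have := hi.2
    have := lam.le_size i
    rw [Finset.mem_Icc]
    simp only [Part.exponent] at *
    omega

theorem exists_first_ne {v w : Fin n → ℤ} (h : v ≠ w) :
    ∃ j, v j ≠ w j ∧ ∀ i < j, v i = w i := by
  have hne : (Finset.univ.filter fun i => v i ≠ w i).Nonempty := by
    obtain ⟨i, hi⟩ := Function.ne_iff.1 h
    exact ⟨i, by simpa using hi⟩
  refine ⟨_, (Finset.mem_filter.1 (Finset.min'_mem _ hne)).2, fun i hi => ?_⟩
  by_contra h'
  exact absurd (Finset.min'_le _ i (by simpa using h')) (not_le.2 hi)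

/-- The alternating double sum of `θ` is the Gram matrix of the dominant monomials. -/
theorem sum_sum_pairing_lower {K : Type*} [Field K] {t : K} (ht : t ≠ 0) (lam mu : Part n) :
    ∑ S : Finset (Fin n), ∑ T : Finset (Fin n), (-1) ^ S.card * (-1) ^ T.card
        * pairing t (lower S lam.exponent) (lower T mu.exponent)
      = if lam = mu then t ^ (-(lam.size : ℤ)) * lam.b t else 0 := by
  have hswap : ∀ v w : Fin n → ℤ,
      ∑ S : Finset (Fin n), ∑ T : Finset (Fin n), (-1) ^ S.card * (-1) ^ T.card
        * pairing t (lower S v) (lower T w)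
      = ∑ T : Finset (Fin n), (-1) ^ T.card *
        ∑ S : Finset (Fin n), (-1) ^ S.card * pairing t (lower S v) (lower T w) := by
    intro v w
    rw [Finset.sum_comm]
    refine Finset.sum_congr rfl fun T _ => ?_
    rw [Finset.mul_sum]
    exact Finset.sum_congr rfl fun S _ => by ring
  split_ifs with h
  · subst h
    rw [hswap, Finset.sum_eq_single ∅]
    · rw [lower_empty, sum_pairing_lower ht _ lam.exponent_nonneg]
      simp only [pairingFactor_sub ht lam.exponent _ (lam.exponent_nonneg _)]
      rw [Finset.prod_mul_distrib, Finset.card_empty, pow_zero, one_mul, ← mul_assoc,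
        ← pairing_eq_prod ht lam.exponent lam.exponent_nonneg,
        lam.pairing_eq_theta, lam.prod_eq_b, Part.theta, lam.nSkew_self]
      simp
    · intro T _ hT
      rw [sum_pairing_lower_eq_zero_of_nonempty ht lam.antitone_exponent lam.exponent_nonneg
        (Finset.nonempty_iff_ne_empty.2 hT), mul_zero]
    · simp
  · have hne : lam.exponent ≠ mu.exponent := fun h' => h (Subtype.ext (funext fun i => by
      simpa [Part.exponent] using congrFun h' i))
    obtain ⟨j, hj, hfirst⟩ := exists_first_ne hne
    -- The inner sum is taken over the lowerings of whichever partition is larger at the first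
    -- difference; that sum already vanishes.
    rcases lt_or_gt_of_ne hj with hlt | hlt
    · refine Finset.sum_eq_zero fun S _ => ?_
      have := sum_pairing_lower_eq_zero_of_lt ht mu.antitone_exponent mu.exponent_nonneg
        lam.antitone_exponent lam.exponent_nonneg (fun i hi => (hfirst i hi).symm) hlt S
      simp only [mul_assoc]
      rw [← Finset.mul_sum]
      simp only [pairing_comm t (lower S lam.exponent)]
      rw [this, mul_zero]
    · rw [hswap]
      refine Finset.sum_eq_zero fun T _ => ?_
      rw [sum_pairing_lower_eq_zero_of_lt ht lam.antitone_exponent lam.exponent_nonneg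
        mu.antitone_exponent mu.exponent_nonneg hfirst hlt T, mul_zero]

end

/-! ### Comparison of the two functions by induction on size. -/

section

variable {K : Type*} [Field K] {n : ℕ}

/-- Functions on `ℤⁿ` that acquire a factor `t` when adjacent coordinates `a, a + 1` are sorted,
and vanish when the last coordinate is negative. -/
structure IsSortable (t : K) (f : (Fin n → ℤ) → K) : Prop where
  of_succ : ∀ (v : Fin n → ℤ) (i j : Fin n), (i : ℕ) + 1 = j → v j = v i + 1 →
    f v = t * f (v ∘ Equiv.swap i j)
  of_lastNeg : ∀ v, LastNeg v → f v = 0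

/-- Sortable functions that agree on partitions of the right size agree on `λ - 1_S`. -/
theorem IsSortable.eq_lower {t : K} {f g : (Fin n → ℤ) → K} (hf : IsSortable t f)
    (hg : IsSortable t g) {v : Fin n → ℤ} (hv : Antitone v) (S : Finset (Fin n))
    (hfg : ∀ nu : Part n, (nu.size : ℤ) = ∑ i, lower S v i → f nu.exponent = g nu.exponent) :
    f (lower S v) = g (lower S v) := by
  have hS0 : ∀ S : Finset (Fin n), 0 ≤ ∑ i : Fin n, (i : ℤ) * (if i ∈ S then 0 else 1) :=
    fun S => Finset.sum_nonneg fun i _ => by positivity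
  induction hN : (∑ i : Fin n, (i : ℤ) * (if i ∈ S then 0 else 1)).toNat
    using Nat.strong_induction_on generalizing S with
  | _ N ih =>
    subst hN
    by_cases ha : Antitone (lower S v)
    · rcases exists_part_or_lastNeg ha with ⟨nu, h⟩ | h
      · rw [h]
        refine hfg nu ?_
        rw [h, nu.sum_exponent]
      · rw [hf.of_lastNeg _ h, hg.of_lastNeg _ h]
    · obtain ⟨i, j, hij, hlt⟩ := exists_lt_succ_of_not_antitone ha
      have hne : i ≠ j := by rintro rfl; omega
      -- Since `v` is antitone, an ascent of `lower S v` forces `v i = v j`, `i ∈ S` and `j ∉ S`, so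
      -- its gap is exactly `1`. Swapping replaces `i` by `j` in `S`, which lowers the index sum of
      -- the complement by one.
      have hle : v j ≤ v i := hv (Fin.le_def.2 (by omega))
      have hiS : i ∈ S := by
        by_contra h
        simp only [lower, h, if_false] at hlt
        split_ifs at hlt <;> omega
      have hjS : j ∉ S := by
        intro h
        simp only [lower, h, hiS, if_true] at hlt
        omega
      have hvij : v j = v i := by
        simp only [lower, hiS, hjS, if_true, if_false] at hlt
        omega
      have hsucc : lower S v j = lower S v i + 1 := by
        simp [lower, hiS, hjS, hvij]
      have hswap : lower S v ∘ Equiv.swap i j = lower (insert j (S.erase i)) v := by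
        funext k
        rcases eq_or_ne k i with rfl | hi
        · simp [lower, hjS, hvij, hne]
        · rcases eq_or_ne k j with rfl | hj
          · simp [lower, hiS, hvij]
          · simp [lower, hi, hj, Equiv.swap_apply_of_ne_of_ne]
      have hsum : ∑ k, lower (insert j (S.erase i)) v k = ∑ k, lower S v k := by
        rw [← hswap]
        exact Equiv.sum_comp (Equiv.swap i j) (lower S v)
      have hmeas : ∑ k : Fin n, (k : ℤ) * (if k ∈ insert j (S.erase i) then 0 else 1)
          = ∑ k : Fin n, (k : ℤ) * (if k ∈ S then 0 else 1) - 1 := by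
        have hc : ∀ k : Fin n, (if k ∈ insert j (S.erase i) then (0 : ℤ) else 1)
            = shift (fun k => if k ∈ S then (0 : ℤ) else 1) i j 1 k := by
          intro k
          rcases eq_or_ne k i with rfl | hi
          · simp [shift, hne, hiS]
          · rcases eq_or_ne k j with rfl | hj
            · simp [shift, hi, hjS]
            · simp [shift, hi, hj]
        simp only [hc]
        rw [sum_shift_mul (fun k => if k ∈ S then (0 : ℤ) else 1) (fun k => (k : ℤ)), ← hij]
        push_cast
        ring
      rw [hf.of_succ _ i j hij hsucc, hg.of_succ _ i j hij hsucc, hswap]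
      congr 1
      refine ih _ ?_ _ (by rwa [hsum]) rfl
      have := hS0 (insert j (S.erase i))
      omega

theorem isSortable_pairing {t : K} (ht : t ≠ 0) (w : Fin n → ℤ) :
    IsSortable t fun v => pairing t v w :=
  ⟨fun v _ _ hij hv => pairing_of_succ ht v w hij hv, fun _ hv => pairing_eq_zero t hv w⟩

/-- The scalar products of the geometric series. -/
def geomPairing (t : K) (B : LinearMap.BilinForm K (Straightened n t)) (v w : Fin n → ℤ) : K :=
  t ^ (-∑ i, v i) * B (cls t (geom t v)) (cls t (geom 1 w))

variable {t : K} (B : LinearMap.BilinForm K (Straightened n t))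

theorem isSortable_geomPairing_left [CharZero K] (w : Fin n → ℤ) :
    IsSortable t fun v => geomPairing t B v w := by
  refine ⟨fun v i j hij hv => ?_, fun v hv => ?_⟩
  · have hsum : ∑ k, (v ∘ Equiv.swap i j) k = ∑ k, v k := Equiv.sum_comp (Equiv.swap i j) v
    simp only [geomPairing]
    rw [cls_geom_of_succ t t v hij hv, hsum, map_smul, LinearMap.smul_apply, smul_eq_mul]
    ring
  · simp only [geomPairing]
    rw [cls_geom_eq_zero t t hv, map_zero, LinearMap.zero_apply, mul_zero]

theorem isSortable_geomPairing_right [CharZero K] (v : Fin n → ℤ) :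
    IsSortable t fun w => geomPairing t B v w := by
  refine ⟨fun w i j hij hw => ?_, fun w hw => ?_⟩
  · simp only [geomPairing]
    rw [cls_geom_of_succ t 1 w hij hw, map_smul, smul_eq_mul]
    ring
  · simp only [geomPairing]
    rw [cls_geom_eq_zero t 1 hw, map_zero, mul_zero]

/-- The normalization `t^{-|v|}` turns the coefficients `(-t)^{|S|}` of `∏ (1 - t/x_i)` into the
signs `(-1)^{|S|}`, so that this system has the same coefficients as the one for `pairing`. -/
theorem sum_sum_geomPairing_lower (ht : t ≠ 0) (v w : Fin n → ℤ) :
    ∑ S : Finset (Fin n), ∑ T : Finset (Fin n), (-1) ^ S.card * (-1) ^ T.card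
        * geomPairing t B (lower S v) (lower T w)
      = t ^ (-∑ i, v i) * B (cls t (mono K v)) (cls t (mono K w)) := by
  rw [mono_eq_sum_geom t v, mono_eq_sum_geom 1 w]
  simp only [cls, map_sum, map_smul, LinearMap.sum_apply, LinearMap.smul_apply, smul_eq_mul,
    Finset.mul_sum]
  rw [Finset.sum_comm]
  refine Finset.sum_congr rfl fun T _ => Finset.sum_congr rfl fun S _ => ?_
  simp only [geomPairing, cls]
  rw [sum_lower, neg_sub, sub_eq_add_neg, zpow_add₀ ht, zpow_natCast, neg_pow t S.card]
  ring

/-- Both functions have the same alternating double sum. Every term other than `(∅, ∅)` sorts, first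
on the left and then on the right, to zero or to partitions of smaller total size, where the
functions agree by induction; the remaining terms must agree as well. -/
theorem geomPairing_eq_pairing [CharZero K] (ht : t ≠ 0) (hB : IsScalarProduct t B)
    (lam mu : Part n) :
    geomPairing t B lam.exponent mu.exponent = pairing t lam.exponent mu.exponent := by
  induction hN : lam.size + mu.size using Nat.strong_induction_on generalizing lam mu with
  | _ N ih =>
    subst hN
    have hlower : ∀ S T : Finset (Fin n), (S, T) ≠ (∅, ∅) →
        geomPairing t B (lower S lam.exponent) (lower T mu.exponent)
          = pairing t (lower S lam.exponent) (lower T mu.exponent) := by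
      intro S T hST
      refine (isSortable_geomPairing_left B _).eq_lower (isSortable_pairing ht _)
        lam.antitone_exponent S fun nu hnu => ?_
      simp only [pairing_comm t nu.exponent]
      refine (isSortable_geomPairing_right B nu.exponent).eq_lower (isSortable_pairing ht _)
        mu.antitone_exponent T fun rho hrho => ?_
      rw [pairing_comm]
      refine ih _ ?_ nu rho rfl
      rw [sum_lower, Part.sum_exponent] at hnu hrho
      have : 0 < S.card ∨ 0 < T.card := by
        by_contra! h
        exact hST (by simp [Finset.card_eq_zero.1 (Nat.le_zero.1 h.1),
          Finset.card_eq_zero.1 (Nat.le_zero.1 h.2)])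
      omega
    have hsum := sum_sum_geomPairing_lower B ht lam.exponent mu.exponent
    rw [hB lam mu, lam.sum_exponent, mul_ite, mul_zero, ← sum_sum_pairing_lower ht lam mu,
      ← Fintype.sum_prod_type', ← Fintype.sum_prod_type',
      Fintype.sum_eq_add_sum_compl (∅, ∅), Fintype.sum_eq_add_sum_compl (∅, ∅)] at hsum
    rw [Finset.sum_congr rfl fun p hp => by
      rw [hlower p.1 p.2 (by simpa using hp)]] at hsum
    simpa [lower_empty] using add_right_cancel hsum

end
end HallLittlewood

theorem mainTheorem6 {K : Type*} [Field K] [CharZero K] (t : K) (ht : Transcendental ℚ t)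
    (n : ℕ) (hn : 0 < n) :
    (∃! B : LinearMap.BilinForm K (HallLittlewood.Straightened n t),
      HallLittlewood.IsScalarProduct t B) ∧
    ∀ B : LinearMap.BilinForm K (HallLittlewood.Straightened n t),
      HallLittlewood.IsScalarProduct t B →
      ∀ lam mu : HallLittlewood.Part n,
        B (HallLittlewood.cls t (t ^ (-(lam.size : ℤ)) • HallLittlewood.geom t lam.exponent))
          (HallLittlewood.cls t (HallLittlewood.geom 1 mu.exponent)) =
        HallLittlewood.Part.theta t lam mu := by
  have ht0 : t ≠ 0 := fun h => ht (h ▸ isAlgebraic_zero)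
  refine ⟨HallLittlewood.existsUnique_isScalarProduct ht, fun B hB lam mu => ?_⟩
  rw [← HallLittlewood.Part.pairing_eq_theta,
    ← HallLittlewood.geomPairing_eq_pairing B ht0 hB, HallLittlewood.geomPairing,
    lam.sum_exponent]
  simp only [HallLittlewood.cls, map_smul, LinearMap.smul_apply, smul_eq_mul]
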